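/- Let $g\ge 2$ and let $\mathcal H_g$ be the Siegel upper half-space of complex symmetric $g\times g$ matrices with positive definite imaginary part. For $\varepsilon,\delta\in\mathbb Z_2^g$ (seen as vectors of zeros and ones), $\tau\in\mathcal H_g$ and $z\in\mathbb C^g$ put $$\theta\!\left[\begin{smallmatrix}\varepsilon\\ \delta\end{smallmatrix}\right](\tau,z)=\sum_{m\in\mathbb Z^g}\exp \pi i\left[\left(m+\tfrac{\varepsilon}{2}\right)\cdot\tau\left(m+\tfrac{\varepsilon}{2}\right)+2\left(m+\tfrac{\varepsilon}{2}\right)\cdot\left(z+\tfrac{\delta}{2}\right)\right],\qquad \Theta[\varepsilon](\tau,z)=\theta\!\left[\begin{smallmatrix}\varepsilon\\ 0\end{smallmatrix}\right](2\tau,2z).$$ Let $\Theta[\varepsilon](\tau)=\Theta[\varepsilon](\tau,0)$, and for $1\le i,j\le g$ let $$A_{ij,\varepsilon\delta}(\tau)=\partial_{z_i}\partial_{z_j}\Theta[\delta](\tau,0)\,\Theta[\varepsilon](\tau,0)-\Theta[\delta](\tau,0)\,\partial_{z_i}\partial_{z_j}\Theta[\varepsilon](\tau,0)$$ (by the heat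 equation $\partial_{z_i}\partial_{z_j}$ may be replaced by $\partial_{\tau_{ij}}$ up to a nonzero constant factor), and $$C_{ij,\varepsilon\delta}(\tau)=2\,\partial_{z_i}\theta\!\left[\begin{smallmatrix}\varepsilon\\ \delta\end{smallmatrix}\right](\tau,0)\,\partial_{z_j}\theta\!\left[\begin{smallmatrix}\varepsilon\\ \delta\end{smallmatrix}\right](\tau,0).$$ A characteristic $[\varepsilon,\delta]$ is odd if $\varepsilon\cdot\delta=1$ in $\mathbb Z_2$; there are $2^{g-1}(2^g-1)$ odd ones. Let $\mathbb P grTh(\tau)$ be the subspace of $\mathbb C^{2^{g-1}(2^g-1)}$ spanned by the $g$ vectors $\big(\partial_{z_i}\theta\!\left[\begin{smallmatrix}\varepsilon\\ \delta\end{smallmatrix}\right](\tau,0)\big)_{[\varepsilon,\delta]\ \mathrm{odd}}$, $i=1,\dots,g$. Then the following hold. 1. For every $\tau\in\mathcal H_g$ the constants $\Theta[\varepsilon](\tau)$, $\varepsilon\in\mathbb Z_2^g$, are not all zero, so that they define a point $\mathbb P Th_2(\tau)\in\mathbb P^{2^g-1}$; and this point is the unique solution in $\mathbb P^{2^g-1}$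 of the system of linear equations in the unknowns $(x_\varepsilon)_{\varepsilon\in\mathbb Z_2^g}$ $$A_{ij,\varepsilon\delta}(\tau)\,x_\sigma+A_{ij,\delta\sigma}(\tau)\,x_\varepsilon+A_{ij,\sigma\varepsilon}(\tau)\,x_\delta=0\qquad\text{for all } 1\le i,j\le g,\ \varepsilon,\delta,\sigma\in\mathbb Z_2^g.$$ 2. For all $\tau\in\mathcal H_g$, $1\le i,j\le g$ and $\alpha,\varepsilon\in\mathbb Z_2^g$, $$A_{ij,\,\alpha+\varepsilon\,\alpha}(\tau)=\frac1{2^{g-1}}\sum_{\sigma\,:\,[\varepsilon,\sigma]\ \mathrm{odd}}(-1)^{\alpha\cdot\sigma}\,C_{ij,\varepsilon\sigma}(\tau).$$ 3. $\mathbb P Th_2(\tau)$ is uniquely determined by $\mathbb P grTh(\tau)$: if $\tau,\tau'\in\mathcal H_g$ satisfy $\mathbb P grTh(\tau)=\mathbb P grTh(\tau')$, then $\mathbb P Th_2(\tau)=\mathbb P Th_2(\tau')$. -/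

import Mathlib

open scoped Matrix LinearAlgebra.Projectivization

noncomputable section

/-- The Siegel upper half-space `ℋ_g`: complex symmetric `g × g` matrices with positive definite
imaginary part. -/
def SiegelUpperHalfSpace (g : ℕ) : Type :=
  {τ : Matrix (Fin g) (Fin g) ℂ // τ.IsSymm ∧ (τ.map Complex.im).PosDef}

/-- Half-characteristics: elements of `(ℤ/2ℤ)^g`. -/
abbrev HalfChar (g : ℕ) : Type := Fin g → ZMod 2

/-- An element of `(ℤ/2ℤ)^g` seen as a complex vector of zeros and ones. -/
def HalfChar.toComplex {g : ℕ} (ε : HalfChar g) : Fin g → ℂ := fun k => ((ε k).val : ℂ)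

/-- The sign `(-1)^(α·σ)`. -/
def pairingSign {g : ℕ} (α σ : HalfChar g) : ℂ := (-1 : ℂ) ^ (α ⬝ᵥ σ).val

/-- The theta function with characteristic `[ε, δ]`:
`θ[ε,δ](τ,z) = ∑_m exp(π i [(m+ε/2)·τ(m+ε/2) + 2 (m+ε/2)·(z+δ/2)])`, the sum being over `ℤ^g`.
The series converges absolutely when `τ` lies in the Siegel upper half-space. -/
def theta {g : ℕ} (ε δ : HalfChar g) (τ : Matrix (Fin g) (Fin g) ℂ) (z : Fin g → ℂ) : ℂ :=
  ∑' m : Fin g → ℤ,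
    let v : Fin g → ℂ := (fun k => (m k : ℂ)) + (2⁻¹ : ℂ) • ε.toComplex
    Complex.exp (Real.pi * Complex.I *
      (v ⬝ᵥ (τ *ᵥ v) + 2 * (v ⬝ᵥ (z + (2⁻¹ : ℂ) • δ.toComplex))))

/-- The partial derivative `∂_{z_i}` of a function on `ℂ^g`. -/
def partialDeriv {g : ℕ} (i : Fin g) (f : (Fin g → ℂ) → ℂ) : (Fin g → ℂ) → ℂ :=
  fun z => lineDeriv ℂ f z (Pi.single i 1)

/-- The function `θ[ε,β](2τ, 2z)`; for `β = 0` it is the theta function of the second order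
`Θ[ε](τ, z)`. -/
def thetaDouble {g : ℕ} (ε β : HalfChar g) (τ : SiegelUpperHalfSpace g) (z : Fin g → ℂ) : ℂ :=
  theta ε β ((2 : ℂ) • τ.1) ((2 : ℂ) • z)

/-- The theta function of the second order `Θ[ε](τ, z) = θ[ε,0](2τ, 2z)`. -/
def secondOrderTheta {g : ℕ} (ε : HalfChar g) (τ : SiegelUpperHalfSpace g) (z : Fin g → ℂ) : ℂ :=
  thetaDouble ε 0 τ z

/-- The vector `(Θ[ε](τ, 0))_ε` of all theta constants of the second order. -/
def secondOrderThetaConstants {g : ℕ} (τ : SiegelUpperHalfSpace g) : HalfChar g → ℂ :=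
  fun ε => secondOrderTheta ε τ 0

/-- `∂_{z_i}` of `θ[ε,δ](τ, z)` at `z = 0`. -/
def thetaGradient {g : ℕ} (τ : SiegelUpperHalfSpace g) (ε δ : HalfChar g) (i : Fin g) : ℂ :=
  partialDeriv i (theta ε δ τ.1) 0

/-- `C^β_{ij,εδ}(τ) = ∂_i θ[ε,β+δ] ∂_j θ[ε,δ] + ∂_j θ[ε,β+δ] ∂_i θ[ε,δ]` at `(τ, 0)`. -/
def thetaC {g : ℕ} (β : HalfChar g) (τ : SiegelUpperHalfSpace g) (i j : Fin g)
    (ε δ : HalfChar g) : ℂ :=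
  thetaGradient τ ε (β + δ) i * thetaGradient τ ε δ j
    + thetaGradient τ ε (β + δ) j * thetaGradient τ ε δ i

/-- `A^β_{ij,εδ}(τ)`, the `2 × 2` minor
`∂_i∂_j θ[δ,β](2τ,2z) · θ[ε,β](2τ,2z) - θ[δ,β](2τ,2z) · ∂_i∂_j θ[ε,β](2τ,2z)` at `z = 0`. -/
def thetaA {g : ℕ} (β : HalfChar g) (τ : SiegelUpperHalfSpace g) (i j : Fin g)
    (ε δ : HalfChar g) : ℂ :=
  partialDeriv i (partialDeriv j (thetaDouble δ β τ)) 0 * thetaDouble ε β τ 0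
    - thetaDouble δ β τ 0 * partialDeriv i (partialDeriv j (thetaDouble ε β τ)) 0

/-- The system of three-term linear equations with coefficients `A`, in the unknowns `x_ε`. -/
def SolvesThreeTermSystem {g : ℕ} (A : Fin g → Fin g → HalfChar g → HalfChar g → ℂ)
    (x : HalfChar g → ℂ) : Prop :=
  ∀ (i j : Fin g) (ε δ σ : HalfChar g),
    A i j ε δ * x σ + A i j δ σ * x ε + A i j σ ε * x δ = 0

/-- A point of projective space solves the system if all vectors on the corresponding line do. -/
def IsProjectiveSolution {g : ℕ} (A : Fin g → Fin g → HalfChar g → HalfChar g → ℂ)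
    (p : ℙ ℂ (HalfChar g → ℂ)) : Prop :=
  ∀ x ∈ p.submodule, SolvesThreeTermSystem A x

/-- Odd characteristics `[ε, δ]`, those with `ε·δ = 1` in `ℤ/2ℤ`. -/
abbrev OddChar (g : ℕ) : Type := {c : HalfChar g × HalfChar g // c.1 ⬝ᵥ c.2 = 1}

/-- `grTh(τ)`: the gradients at `z = 0` of all odd theta functions. -/
def grTh {g : ℕ} (τ : SiegelUpperHalfSpace g) : OddChar g → Fin g → ℂ :=
  fun c i => thetaGradient τ c.1.1 c.1.2 i

/-- `ℙgrTh(τ)`: the subspace of `ℂ^{odd characteristics}` spanned by the `g` vectors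
`(∂_{z_i} θ[ε,δ](τ,0))_{[ε,δ] odd}`, `i = 1, …, g`. Two `g`-tuples of vectors have the same span
exactly when they differ by the action of an element of `GL(g, ℂ)`. -/
def PgrTh {g : ℕ} (τ : SiegelUpperHalfSpace g) : Submodule ℂ (OddChar g → ℂ) :=
  Submodule.span ℂ (Set.range fun (i : Fin g) (c : OddChar g) => grTh τ c i)

end

/-! Everything rests on Riemann's addition formula `theta_add_mul_theta_sub`, which expands
`θ(z+w)θ(z-w)` in products `Θ(z)Θ(w)`. At `w = 0` it writes `θ²` as a combination of the `Θ[α](z)`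
with the theta constants as coefficients; since `θ` is not identically zero, the constants cannot
all vanish.

For odd `[ε,σ]` two derivatives of this formula at `z = 0` express the products of gradients as a
character sum of the minors `A`. For even `[ε,σ]` the same character sum is zero by antisymmetry.
Fourier inversion on `(ℤ/2)^g` gives the formula for `A` (`thetaA_eq_sum_thetaC`).

The theta constants `T` solve the system by a Plücker identity. If `x` is a solution not
proportional to `T`, every `A_ij` is a scalar `s_ij` times the one 2-form `x ∧ T`. All matrices
`∂_iθ ∂_jθ` are then multiples of `(s_ij)`; having rank at most one, they force all odd gradients to
lie on one line. For `g ≥ 2` this contradicts the fact that they span `ℂ^g`.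

Spanning is `eq_zero_of_forall_dotProduct_thetaGradient_eq_zero`. If `v` is orthogonal to all odd
gradients, the formula for `A` makes each Hessian `(∂_w∂_vΘ[δ])_δ` a multiple `c(w) T`. Two
derivatives of the addition formula at `w = 0` turn this into `∂_w∂_v log θ = c(w)/2`, so `∂_v log
θ` is affine. Periodicity under `e_k` kills `c`, and then quasi-periodicity under `τ e_k` gives `v_k
= 0`.

Finally, a linear substitution in the gradients transforms `A` by a quadratic expression in the
substitution, so the span of the gradients already determines the solution. -/

/-- The series `∑ a_n exp(lam_n · z)` of exponentials of linear forms. -/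
noncomputable def expSeries {ι : Type*} {g : ℕ} (a : ι → ℂ) (lam : ι → Fin g → ℂ)
    (z : Fin g → ℂ) : ℂ :=
  ∑' n, a n * Complex.exp (lam n ⬝ᵥ z)

/-- The coefficients decay faster than every exponential of the frequencies. -/
def ExpDecay {ι : Type*} {g : ℕ} (a : ι → ℂ) (lam : ι → Fin g → ℂ) : Prop :=
  ∀ R : ℝ, Summable fun n => ‖a n‖ * Real.exp (R * ‖lam n‖)

/-- Coefficients of the derivative of `expSeries a lam` in the direction `v`. -/
def dirCoeff {ι : Type*} {g : ℕ} (lam : ι → Fin g → ℂ) (v : Fin g → ℂ) (a : ι → ℂ) : ι → ℂ :=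
  fun n => (lam n ⬝ᵥ v) * a n

/-! ### Termwise differentiation of exponential series. -/

section ExpSeries

variable {ι : Type*} {g : ℕ} {a : ι → ℂ} {lam : ι → Fin g → ℂ}

theorem norm_dotProduct_le_card_mul (x y : Fin g → ℂ) : ‖x ⬝ᵥ y‖ ≤ g * ‖y‖ * ‖x‖ := by
  calc ‖x ⬝ᵥ y‖ ≤ ∑ i, ‖x i * y i‖ := norm_sum_le _ _
    _ ≤ ∑ _i : Fin g, ‖x‖ * ‖y‖ := by
        refine Finset.sum_le_sum fun i _ => ?_
        rw [norm_mul]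
        exact mul_le_mul (norm_le_pi_norm x i) (norm_le_pi_norm y i) (norm_nonneg _)
          (norm_nonneg _)
    _ = g * ‖y‖ * ‖x‖ := by simp; ring

/-- The linear factor is at most a constant times `exp ‖lam n‖`, and decay at rate `R + 1` absorbs
it. -/
theorem ExpDecay.dirCoeff (h : ExpDecay a lam) (v : Fin g → ℂ) :
    ExpDecay (dirCoeff lam v a) lam := by
  intro R
  refine Summable.of_nonneg_of_le (fun n => by positivity) (fun n => ?_)
    ((h (R + 1)).mul_left (g * ‖v‖))
  have h1 : ‖lam n ⬝ᵥ v‖ ≤ g * ‖v‖ * Real.exp ‖lam n‖ :=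
    (norm_dotProduct_le_card_mul _ _).trans (mul_le_mul_of_nonneg_left
      ((by linarith : ‖lam n‖ ≤ ‖lam n‖ + 1).trans (Real.add_one_le_exp _)) (by positivity))
  have h2 : Real.exp ((R + 1) * ‖lam n‖) = Real.exp ‖lam n‖ * Real.exp (R * ‖lam n‖) := by
    rw [← Real.exp_add]; ring_nf
  rw [_root_.dirCoeff, norm_mul, h2]
  calc ‖lam n ⬝ᵥ v‖ * ‖a n‖ * Real.exp (R * ‖lam n‖)
      ≤ (g * ‖v‖ * Real.exp ‖lam n‖) * ‖a n‖ * Real.exp (R * ‖lam n‖) := by gcongr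
    _ = _ := by ring

theorem ExpDecay.norm_term_le (z : Fin g → ℂ) {r : ℝ} (hz : ‖z‖ ≤ r) (n : ι) :
    ‖a n * Complex.exp (lam n ⬝ᵥ z)‖ ≤ ‖a n‖ * Real.exp ((g * r) * ‖lam n‖) := by
  rw [norm_mul, Complex.norm_exp]
  gcongr
  refine (Complex.re_le_norm _).trans ((norm_dotProduct_le_card_mul _ _).trans ?_)
  gcongr

theorem ExpDecay.summable_norm (h : ExpDecay a lam) (z : Fin g → ℂ) :
    Summable fun n => ‖a n * Complex.exp (lam n ⬝ᵥ z)‖ :=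
  Summable.of_nonneg_of_le (fun _ => norm_nonneg _)
    (fun n => ExpDecay.norm_term_le z le_rfl n) (h _)

theorem ExpDecay.summable (h : ExpDecay a lam) (z : Fin g → ℂ) :
    Summable fun n => a n * Complex.exp (lam n ⬝ᵥ z) :=
  (h.summable_norm z).of_norm

theorem ExpDecay.hasDerivAt (h : ExpDecay a lam) (z v : Fin g → ℂ) (t : ℂ) :
    HasDerivAt (fun s : ℂ => expSeries a lam (z + s • v))
      (expSeries (_root_.dirCoeff lam v a) lam (z + t • v)) t := by
  have hb : ∀ y ∈ Metric.ball (0 : ℂ) (‖t‖ + 1), ‖z + y • v‖ ≤ ‖z‖ + (‖t‖ + 1) * ‖v‖ := by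
    intro y hy
    refine (norm_add_le _ _).trans ?_
    rw [norm_smul]
    have : ‖y‖ ≤ ‖t‖ + 1 := by simpa using (mem_ball_zero_iff.1 hy).le
    gcongr
  have ht : t ∈ Metric.ball (0 : ℂ) (‖t‖ + 1) := by simp
  refine hasDerivAt_tsum_of_isPreconnected
    (g := fun n s => a n * Complex.exp (lam n ⬝ᵥ (z + s • v)))
    (g' := fun n s => _root_.dirCoeff lam v a n * Complex.exp (lam n ⬝ᵥ (z + s • v)))
    (t := Metric.ball (0 : ℂ) (‖t‖ + 1)) ((h.dirCoeff v) (g * (‖z‖ + (‖t‖ + 1) * ‖v‖)))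
    Metric.isOpen_ball (convex_ball _ _).isPreconnected ?_ ?_ ht (h.summable _) ht
  · intro n y _
    have h1 : HasDerivAt (fun s : ℂ => lam n ⬝ᵥ (z + s • v)) (lam n ⬝ᵥ v) y := by
      simp only [dotProduct_add, dotProduct_smul, smul_eq_mul]
      simpa using ((hasDerivAt_id y).mul_const (lam n ⬝ᵥ v)).const_add (lam n ⬝ᵥ z)
    convert! (h1.cexp.const_mul (a n)) using 1
    simp only [_root_.dirCoeff]; ring
  · intro n y hy
    exact ExpDecay.norm_term_le _ (hb y hy) n

theorem ExpDecay.hasLineDerivAt (h : ExpDecay a lam) (z v : Fin g → ℂ) :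
    HasLineDerivAt ℂ (expSeries a lam) (expSeries (_root_.dirCoeff lam v a) lam z) z v := by
  have := h.hasDerivAt z v 0
  rw [zero_smul, add_zero] at this
  exact this

theorem ExpDecay.partialDeriv (h : ExpDecay a lam) (i : Fin g) :
    partialDeriv i (expSeries a lam) =
      expSeries (_root_.dirCoeff lam (Pi.single i 1) a) lam :=
  funext fun z => (h.hasLineDerivAt z _).lineDeriv

theorem ExpDecay.expSeries_dirCoeff (h : ExpDecay a lam) (v z : Fin g → ℂ) :
    expSeries (_root_.dirCoeff lam v a) lam z =
      ∑ i, v i * expSeries (_root_.dirCoeff lam (Pi.single i 1) a) lam z := by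
  simp only [expSeries, ← tsum_mul_left]
  rw [← Summable.tsum_finsetSum fun i _ => ((h.dirCoeff _).summable z).mul_left _]
  refine tsum_congr fun n => ?_
  simp only [_root_.dirCoeff, dotProduct_single, mul_one]
  rw [dotProduct, Finset.sum_mul, Finset.sum_mul]
  exact Finset.sum_congr rfl fun i _ => by ring

theorem dirCoeff_comm (v w : Fin g → ℂ) :
    dirCoeff lam v (dirCoeff lam w a) = dirCoeff lam w (dirCoeff lam v a) := by
  funext n; simp only [dirCoeff]; ring

theorem ExpDecay.expSeries_dirCoeff_dirCoeff (h : ExpDecay a lam) (v w z : Fin g → ℂ) :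
    expSeries (_root_.dirCoeff lam v (_root_.dirCoeff lam w a)) lam z =
      ∑ i, ∑ j, v i * w j * expSeries (_root_.dirCoeff lam (Pi.single i 1)
        (_root_.dirCoeff lam (Pi.single j 1) a)) lam z := by
  rw [(h.dirCoeff w).expSeries_dirCoeff]
  refine Finset.sum_congr rfl fun i _ => ?_
  rw [dirCoeff_comm, (h.dirCoeff _).expSeries_dirCoeff, Finset.mul_sum]
  refine Finset.sum_congr rfl fun j _ => ?_
  rw [dirCoeff_comm]; ring

end ExpSeries

/-! ### A Wronskian equation. -/

/-- If two entire functions `f`, `h` satisfy `f h' - h f' = c f²` and `f 0 ≠ 0`, then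
`h = (c t + h 0 / f 0) f`. -/
theorem eq_affine_mul_of_wronskian_eq {f h f' h' : ℂ → ℂ} {c : ℂ}
    (hf : ∀ t, HasDerivAt f (f' t) t) (hh : ∀ t, HasDerivAt h (h' t) t) (h0 : f 0 ≠ 0)
    (hW : ∀ t, f t * h' t - h t * f' t = c * f t ^ 2) (t : ℂ) :
    h t = (c * t + h 0 / f 0) * f t := by
  set k : ℂ → ℂ := fun t => h t - (c * t + h 0 / f 0) * f t with hk
  have dk : ∀ t, HasDerivAt k (h' t - (c * f t + (c * t + h 0 / f 0) * f' t)) t := fun t => by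
    have := (((hasDerivAt_id t).const_mul c).add_const (h 0 / f 0)).mul (hf t)
    simp only [mul_one, id] at this
    exact (hh t).sub this
  have hkd : Differentiable ℂ k := fun t => (dk t).differentiableAt
  obtain ⟨r, hr, hball⟩ := Metric.isOpen_iff.1
    ((isOpen_compl_singleton (x := (0 : ℂ))).preimage
      (continuous_iff_continuousAt.2 fun t => (hf t).continuousAt)) 0 h0
  -- The hypothesis on the Wronskian says that `k / f` has derivative zero wherever `f ≠ 0`. The
  -- identity theorem for the entire function `k` then carries `k = 0` past the zeros of `f`.
  have hq : ∀ t ∈ Metric.ball (0 : ℂ) r, k t / f t = k 0 / f 0 := by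
    intro t ht
    refine (convex_ball (0 : ℂ) r).is_const_of_fderivWithin_eq_zero (𝕜 := ℂ)
      (f := fun t => k t / f t) ?_ ?_ ht (Metric.mem_ball_self hr)
    · intro s hs
      exact ((dk s).div (hf s) (hball hs)).differentiableAt.differentiableWithinAt
    · intro s hs
      have hs0 : f s ≠ 0 := hball hs
      have := (dk s).div (hf s) hs0
      rw [fderivWithin_of_isOpen Metric.isOpen_ball hs]
      have hz : ((h' s - (c * f s + (c * s + h 0 / f 0) * f' s)) * f s - k s * f' s) / f s ^ 2
          = 0 := by
        rw [div_eq_zero_iff]; left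
        simp only [hk]
        linear_combination hW s
      rw [hz] at this
      ext
      simpa using! this.deriv
  have hk0 : k 0 = 0 := by simp only [hk]; field_simp; ring
  have hkz : k = 0 := by
    refine AnalyticOnNhd.eq_of_eventuallyEq (z₀ := 0) (fun t _ => hkd.analyticAt t)
      (fun t _ => analyticAt_const) ?_
    filter_upwards [Metric.ball_mem_nhds (0 : ℂ) hr] with t ht
    have := hq t ht
    rw [hk0, zero_div, div_eq_zero_iff] at this
    exact this.resolve_right (hball ht)
  exact sub_eq_zero.1 (congrFun hkz t)

/-! ### Convergence of theta series. -/

theorem summable_pi_prod {f : ℤ → ℝ} (hf : Summable f) (h0 : ∀ n, 0 ≤ f n) (g : ℕ) :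
    Summable fun n : Fin g → ℤ => ∏ i, f (n i) := by
  induction g with
  | zero => exact (hasSum_fintype _).summable
  | succ g ih =>
    rw [← (Fin.consEquiv fun _ : Fin (g + 1) => ℤ).summable_iff]
    refine (hf.mul_of_nonneg ih h0 fun n => Finset.prod_nonneg fun i _ => h0 _).congr fun n => ?_
    simp [Fin.prod_univ_succ, Fin.consEquiv]

/-- The factor `g` makes the sup norm dominate the `ℓ¹` norm, so a product of one-variable series is
a majorant. -/
theorem summable_exp_neg_norm (g : ℕ) :
    Summable fun n : Fin g → ℤ => Real.exp (-(g * ‖n‖)) := by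
  have h1 : Summable fun k : ℤ => Real.exp (-|(k : ℝ)|) := by
    refine Summable.of_nat_of_neg ?_ ?_ <;>
    · simp only [Int.cast_neg, abs_neg, Int.cast_natCast, Nat.abs_cast]
      exact Real.summable_exp_neg_nat
  refine Summable.of_nonneg_of_le (fun _ => (Real.exp_pos _).le) (fun n => ?_)
    (summable_pi_prod h1 (fun _ => (Real.exp_pos _).le) g)
  rw [← Real.exp_sum, Real.exp_le_exp, Finset.sum_neg_distrib, neg_le_neg_iff]
  calc ∑ i, |(n i : ℝ)| ≤ ∑ _i : Fin g, ‖n‖ :=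
        Finset.sum_le_sum fun i _ => by
          simpa [Int.norm_eq_abs] using norm_le_pi_norm n i
    _ = g * ‖n‖ := by simp

theorem Matrix.PosDef.exists_mul_sq_norm_le {g : ℕ} {Y : Matrix (Fin g) (Fin g) ℝ}
    (hY : Y.PosDef) : ∃ c > 0, ∀ x : Fin g → ℝ, c * ‖x‖ ^ 2 ≤ x ⬝ᵥ (Y *ᵥ x) := by
  have hpos : ∀ x : Fin g → ℝ, x ≠ 0 → 0 < x ⬝ᵥ (Y *ᵥ x) := fun x hx => by
    simpa using (Matrix.posDef_iff_dotProduct_mulVec.1 hY).2 hx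
  rcases (Metric.sphere (0 : Fin g → ℝ) 1).eq_empty_or_nonempty with he | hne
  · refine ⟨1, one_pos, fun x => ?_⟩
    have hx : x = 0 := by
      by_contra hx
      have : ‖x‖⁻¹ • x ∈ Metric.sphere (0 : Fin g → ℝ) 1 := by
        simp [norm_smul, inv_mul_cancel₀ (norm_ne_zero_iff.2 hx)]
      simp [he] at this
    simp [hx]
  · obtain ⟨u, hu, hmin⟩ := (isCompact_sphere (0 : Fin g → ℝ) 1).exists_isMinOn hne
      (f := fun x => x ⬝ᵥ (Y *ᵥ x)) (by
        refine Continuous.continuousOn ?_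
        exact Continuous.dotProduct continuous_id (Continuous.matrix_mulVec continuous_const
          continuous_id))
    refine ⟨u ⬝ᵥ (Y *ᵥ u), hpos u ?_, fun x => ?_⟩
    · rintro rfl; simp at hu
    rcases eq_or_ne x 0 with rfl | hx
    · simp
    have hn := norm_ne_zero_iff.2 hx
    have : ‖x‖⁻¹ • x ∈ Metric.sphere (0 : Fin g → ℝ) 1 := by
      simp [norm_smul, inv_mul_cancel₀ hn]
    have h1 : u ⬝ᵥ (Y *ᵥ u) ≤ (‖x‖⁻¹ • x) ⬝ᵥ (Y *ᵥ (‖x‖⁻¹ • x)) := hmin this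
    rw [Matrix.mulVec_smul, dotProduct_smul, smul_dotProduct, smul_eq_mul, smul_eq_mul] at h1
    calc _ ≤ (‖x‖⁻¹ * (‖x‖⁻¹ * (x ⬝ᵥ (Y *ᵥ x)))) * ‖x‖ ^ 2 := by gcongr
      _ = _ := by field_simp

section ThetaSeries

variable {g : ℕ}

/-- The point `n + ε/2`. -/
noncomputable def thetaPoint (ε : HalfChar g) (n : Fin g → ℤ) : Fin g → ℂ :=
  (fun k => (n k : ℂ)) + (2⁻¹ : ℂ) • ε.toComplex

/-- The Fourier coefficients of `theta ε δ τ`. -/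
noncomputable def thetaCoeff (ε δ : HalfChar g) (τ : Matrix (Fin g) (Fin g) ℂ) (n : Fin g → ℤ) :
    ℂ :=
  Complex.exp (Real.pi * Complex.I *
    (thetaPoint ε n ⬝ᵥ (τ *ᵥ thetaPoint ε n) + thetaPoint ε n ⬝ᵥ δ.toComplex))

/-- The frequencies of `z ↦ theta ε δ τ (c • z)`. -/
noncomputable def thetaFreq (c : ℂ) (ε : HalfChar g) (n : Fin g → ℤ) : Fin g → ℂ :=
  (2 * Real.pi * Complex.I * c) • thetaPoint ε n

theorem theta_smul_eq_expSeries (ε δ : HalfChar g) (τ : Matrix (Fin g) (Fin g) ℂ) (c : ℂ)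
    (z : Fin g → ℂ) :
    theta ε δ τ (c • z) = expSeries (thetaCoeff ε δ τ) (thetaFreq c ε) z := by
  refine tsum_congr fun n => ?_
  dsimp only
  rw [thetaCoeff, ← Complex.exp_add]
  congr 1
  simp only [thetaFreq, thetaPoint, dotProduct_add, dotProduct_smul, smul_dotProduct, smul_eq_mul]
  ring

theorem norm_thetaCoeff (ε δ : HalfChar g) (τ : Matrix (Fin g) (Fin g) ℂ) (n : Fin g → ℤ) :
    ‖thetaCoeff ε δ τ n‖ = Real.exp (-Real.pi *
      ((fun k => (n k : ℝ) + (ε k).val / 2) ⬝ᵥ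
        (τ.map Complex.im *ᵥ fun k => (n k : ℝ) + (ε k).val / 2))) := by
  have hp : thetaPoint ε n = fun k => (((n k : ℝ) + (ε k).val / 2 : ℝ) : ℂ) := by
    funext k
    simp only [thetaPoint, HalfChar.toComplex, Pi.add_apply, Pi.smul_apply, smul_eq_mul]
    push_cast; ring
  rw [thetaCoeff, Complex.norm_exp]
  congr 1
  have h1 : (thetaPoint ε n ⬝ᵥ (τ *ᵥ thetaPoint ε n)).im =
      (fun k => (n k : ℝ) + (ε k).val / 2) ⬝ᵥ
        (τ.map Complex.im *ᵥ fun k => (n k : ℝ) + (ε k).val / 2) := by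
    simp only [hp, dotProduct, Matrix.mulVec, Complex.im_sum, Complex.im_ofReal_mul,
      Complex.im_mul_ofReal, Matrix.map_apply]
  have h2 : (thetaPoint ε n ⬝ᵥ δ.toComplex).im = 0 := by
    rw [hp]
    simp only [dotProduct, Complex.im_sum, Complex.im_ofReal_mul, HalfChar.toComplex,
      Complex.natCast_im, mul_zero, Finset.sum_const_zero]
  rw [mul_assoc, Complex.re_ofReal_mul, Complex.I_mul_re, Complex.add_im, h1, h2]
  ring

/-- The Gaussian factor from the positive definite imaginary part beats any linear exponent, by
completing the square. The `+ g` in `B` reserves room for the majorant `exp (-(g * ‖n‖))`. -/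
theorem expDecay_theta (c : ℂ) (ε δ : HalfChar g) {τ : Matrix (Fin g) (Fin g) ℂ}
    (hτ : (τ.map Complex.im).PosDef) : ExpDecay (thetaCoeff ε δ τ) (thetaFreq c ε) := by
  intro R
  obtain ⟨A, hA, hmin⟩ := hτ.exists_mul_sq_norm_le
  set B : ℝ := |R| * ‖(2 * Real.pi * Complex.I * c)‖ + g with hB
  have hA' : 0 < Real.pi * A := by positivity
  refine Summable.of_nonneg_of_le (fun n => by positivity) (fun n => ?_)
    ((summable_exp_neg_norm g).mul_left (Real.exp (B ^ 2 / (4 * (Real.pi * A)) + g)))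
  set p : Fin g → ℝ := fun k => (n k : ℝ) + (ε k).val / 2 with hp
  have hval : ∀ k, ((ε k).val : ℝ) / 2 ≤ 1 := fun k => by
    have : (ε k).val < 2 := ZMod.val_lt _
    have : ((ε k).val : ℝ) ≤ 1 := by exact_mod_cast Nat.lt_succ_iff.1 this
    linarith
  have hnp : ‖n‖ ≤ ‖p‖ + 1 := by
    refine (pi_norm_le_iff_of_nonneg (by positivity)).2 fun k => ?_
    have h1 : |(n k : ℝ) + (ε k).val / 2| ≤ ‖p‖ := by
      simpa [hp] using norm_le_pi_norm p k
    have h2 : (0 : ℝ) ≤ ((ε k).val : ℝ) / 2 := by positivity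
    rw [Int.norm_eq_abs]
    rw [abs_le] at h1 ⊢
    constructor <;> linarith [hval k]
  have hfreq : ‖thetaFreq c ε n‖ ≤ ‖(2 * Real.pi * Complex.I * c)‖ * ‖p‖ := by
    rw [thetaFreq, norm_smul]
    gcongr
    refine (pi_norm_le_iff_of_nonneg (by positivity)).2 fun k => ?_
    have h1 : thetaPoint ε n k = ((p k : ℝ) : ℂ) := by
      simp only [thetaPoint, HalfChar.toComplex, Pi.add_apply, Pi.smul_apply, smul_eq_mul, hp]
      push_cast; ring
    rw [h1, Complex.norm_real]
    exact norm_le_pi_norm p k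
  rw [norm_thetaCoeff, ← Real.exp_add, ← Real.exp_add, Real.exp_le_exp]
  have h1 : R * ‖thetaFreq c ε n‖ ≤ |R| * (‖(2 * Real.pi * Complex.I * c)‖ * ‖p‖) :=
    (mul_le_mul_of_nonneg_right (le_abs_self R) (norm_nonneg _)).trans
      (mul_le_mul_of_nonneg_left hfreq (abs_nonneg R))
  have h2 : Real.pi * (A * ‖p‖ ^ 2) ≤ Real.pi * (p ⬝ᵥ (τ.map Complex.im *ᵥ p)) :=
    mul_le_mul_of_nonneg_left (hmin p) Real.pi_pos.le
  have h3 : (g : ℝ) * ‖n‖ ≤ g * (‖p‖ + 1) := by gcongr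
  have h4 : B * ‖p‖ ≤ Real.pi * A * ‖p‖ ^ 2 + B ^ 2 / (4 * (Real.pi * A)) := by
    have h5 : Real.pi * A * ‖p‖ ^ 2 + B ^ 2 / (4 * (Real.pi * A)) - B * ‖p‖ =
        (2 * (Real.pi * A) * ‖p‖ - B) ^ 2 / (4 * (Real.pi * A)) := by
      field_simp; ring
    have h6 : 0 ≤ (2 * (Real.pi * A) * ‖p‖ - B) ^ 2 / (4 * (Real.pi * A)) := by positivity
    linarith
  have h7 : B * ‖p‖ = |R| * (‖(2 * Real.pi * Complex.I * c)‖ * ‖p‖) + g * ‖p‖ := by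
    rw [hB]; ring
  linarith

theorem expSeries_add_int (b : (Fin g → ℤ) → ℂ) (k : Fin g)
    (z : Fin g → ℂ) :
    expSeries b (thetaFreq 1 0) (z + Pi.single k 1) = expSeries b (thetaFreq 1 0) z := by
  refine tsum_congr fun n => ?_
  rw [dotProduct_add, Complex.exp_add]
  have : thetaFreq 1 0 n ⬝ᵥ Pi.single k 1 = (n k : ℂ) * (2 * Real.pi * Complex.I) := by
    simp [thetaFreq, thetaPoint, HalfChar.toComplex]; ring
  rw [this, Complex.exp_int_mul_two_pi_mul_I, mul_one]

end ThetaSeries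

/-! ### Quasi-periodicity, nonvanishing and the addition formula. -/

section ThetaFunction

variable {g : ℕ}

/-- Translating the summation index by `e_k` completes the quadratic form. The weight `φ` covers `θ`
(`φ = 1`) and `∂_v θ` (`φ` linear in `n`) at once. -/
theorem expSeries_add_tau {τ : Matrix (Fin g) (Fin g) ℂ} (hτ : τ.IsSymm)
    (φ : (Fin g → ℤ) → ℂ) (k : Fin g) (z : Fin g → ℂ) :
    expSeries (fun n => φ n * thetaCoeff 0 0 τ n) (thetaFreq 1 0) (z + τ *ᵥ Pi.single k 1) =
      Complex.exp (-(Real.pi * Complex.I * (τ k k + 2 * z k))) *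
        expSeries (fun n => φ (n - Pi.single k 1) * thetaCoeff 0 0 τ n) (thetaFreq 1 0) z := by
  symm
  rw [expSeries, expSeries, ← (Equiv.addRight (Pi.single k (1 : ℤ))).tsum_eq, ← tsum_mul_left]
  refine tsum_congr fun n => ?_
  have hp : thetaPoint (0 : HalfChar g) (n + Pi.single k 1) =
      thetaPoint 0 n + Pi.single k 1 := by
    funext i
    by_cases h : i = k
    · subst h; simp [thetaPoint, HalfChar.toComplex]
    · simp [thetaPoint, HalfChar.toComplex, h]
  have hs : (Pi.single k 1 : Fin g → ℂ) ⬝ᵥ (τ *ᵥ thetaPoint 0 n) =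
      thetaPoint 0 n ⬝ᵥ (τ *ᵥ Pi.single k 1) := by
    rw [Matrix.dotProduct_mulVec, dotProduct_comm, ← Matrix.mulVec_transpose, hτ.eq]
  have hkk : (Pi.single k 1 : Fin g → ℂ) ⬝ᵥ (τ *ᵥ Pi.single k 1) = τ k k := by simp
  have hz : (Pi.single k 1 : Fin g → ℂ) ⬝ᵥ z = z k := by simp
  have h0 : (0 : HalfChar g).toComplex = 0 := by funext i; simp [HalfChar.toComplex]
  simp only [Equiv.coe_addRight, add_sub_cancel_right, thetaCoeff, thetaFreq, hp, h0,
    dotProduct_zero, add_zero]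
  have key : ∀ A B C D E : ℂ, A + B + C = D + E →
      Complex.exp A * (φ n * Complex.exp B * Complex.exp C) =
        φ n * Complex.exp D * Complex.exp E := fun A B C D E h => by
    have := congrArg Complex.exp h
    rw [Complex.exp_add, Complex.exp_add, Complex.exp_add] at this
    linear_combination φ n * this
  apply key
  simp only [Matrix.mulVec_add, dotProduct_add, add_dotProduct, smul_dotProduct, smul_eq_mul, hs,
    hkk, hz]
  ring

/-- A trigonometric series with a nonzero constant term does not vanish identically. -/
theorem exists_expSeries_ne_zero {a : (Fin g → ℤ) → ℂ} (ha : Summable fun n => ‖a n‖)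
    (h0 : a 0 ≠ 0) : ∃ z, expSeries a (thetaFreq 1 0) z ≠ 0 := by
  by_contra! hz
  apply h0
  have hs : Summable fun n => a n • UnitAddTorus.mFourier (d := Fin g) n := by
    refine Summable.of_norm (ha.congr fun n => ?_)
    rw [norm_smul, UnitAddTorus.mFourier_norm, mul_one]
  have hF : ∑' n, a n • UnitAddTorus.mFourier (d := Fin g) n = 0 := by
    ext x
    obtain ⟨y, rfl⟩ : ∃ y : Fin g → ℝ, (fun i => (y i : UnitAddCircle)) = x :=
      ⟨fun i => (QuotientAddGroup.mk_surjective (x i)).choose,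
        funext fun i => (QuotientAddGroup.mk_surjective (x i)).choose_spec⟩
    have := ContinuousMap.tsum_apply hs (fun i => (y i : UnitAddCircle))
    rw [← this, ContinuousMap.zero_apply, ← hz fun i => (y i : ℂ)]
    refine tsum_congr fun n => ?_
    simp only [ContinuousMap.smul_apply, smul_eq_mul, UnitAddTorus.mFourier,
      ContinuousMap.coe_mk, fourier_coe_apply]
    rw [← Complex.exp_sum]
    congr 2
    simp only [thetaFreq, thetaPoint, HalfChar.toComplex, dotProduct, Pi.smul_apply,
      Pi.add_apply, Pi.zero_apply, ZMod.val_zero, smul_eq_mul]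
    exact Finset.sum_congr rfl fun i _ => by push_cast; ring
  let : MeasureTheory.MeasureSpace UnitAddCircle := ⟨AddCircle.haarAddCircle⟩
  have : MeasureTheory.IsProbabilityMeasure
      (MeasureTheory.volume : MeasureTheory.Measure UnitAddCircle) :=
    inferInstanceAs (MeasureTheory.IsProbabilityMeasure AddCircle.haarAddCircle)
  have hL := hs.hasSum.mapL (ContinuousMap.toLp (E := ℂ) 2
    (MeasureTheory.volume : MeasureTheory.Measure (UnitAddTorus (Fin g))) ℂ)
  rw [hF, map_zero] at hL
  have hL' : HasSum (fun n => a n • UnitAddTorus.mFourierLp (d := Fin g) 2 n) 0 := by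
    convert! hL using 2
  -- Pairing with the trivial character in `L²` of the torus isolates the coefficient `a 0`.
  have hI := hL'.mapL (innerSL ℂ (UnitAddTorus.mFourierLp (d := Fin g) 2 0))
  rw [map_zero] at hI
  have hon := orthonormal_iff_ite.1 (UnitAddTorus.orthonormal_mFourier (d := Fin g)) 0
  have hI' : HasSum (fun n : Fin g → ℤ => if 0 = n then a n else 0) 0 := by
    convert! hI using 2 with n
    rw [innerSL_apply_apply, inner_smul_right, hon]
    simp
  refine HasSum.unique ?_ hI'
  simpa using hasSum_single (f := fun n : Fin g → ℤ => if 0 = n then a n else 0) 0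
    fun n hn => if_neg (Ne.symm hn)

theorem exp_pi_mul_I_mul_int (N : ℤ) :
    Complex.exp (Real.pi * Complex.I * N) = (-1 : ℂ) ^ ((N : ZMod 2)).val := by
  rw [mul_comm, Complex.exp_int_mul, Complex.exp_pi_mul_I]
  rcases Int.even_or_odd N with h | h
  · rw [h.neg_one_zpow, (ZMod.intCast_zmod_eq_zero_iff_dvd N 2).2 h.two_dvd]; simp
  · rw [h.neg_one_zpow]
    obtain ⟨k, rfl⟩ := h
    have : ((2 * k + 1 : ℤ) : ZMod 2) = 1 := by
      push_cast
      rw [show (2 : ZMod 2) = 0 from rfl, zero_mul, zero_add]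
    rw [this]; exact (pow_one (-1 : ℂ)).symm

theorem exp_two_mul_thetaPoint (α σ : HalfChar g) (n : Fin g → ℤ) :
    Complex.exp (Real.pi * Complex.I * (2 * (thetaPoint α n ⬝ᵥ σ.toComplex))) =
      pairingSign α σ := by
  have h1 : 2 * (thetaPoint α n ⬝ᵥ σ.toComplex) =
      ((∑ i, (2 * n i + (α i).val) * (σ i).val : ℤ) : ℂ) := by
    simp only [dotProduct, thetaPoint, HalfChar.toComplex, Finset.mul_sum, Pi.add_apply,
      Pi.smul_apply, smul_eq_mul]
    push_cast
    exact Finset.sum_congr rfl fun i _ => by ring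
  rw [h1, exp_pi_mul_I_mul_int, pairingSign]
  congr 2
  push_cast
  simp only [dotProduct, ZMod.natCast_val, ZMod.cast_id', id]
  exact Finset.sum_congr rfl fun i _ => by
    rw [show (2 : ZMod 2) = 0 from rfl, zero_mul, zero_add]

/-- The change of the summation indices in the addition formula: it sends `(α, k, l)` to the
pair `(m, n)` with `m + ε/2 = u + v`, `n + ε/2 = u - v`, where `u = k + (α + ε)/2` and
`v = l + α/2`. -/
def additionIndex (ε : HalfChar g) (x : HalfChar g × (Fin g → ℤ) × (Fin g → ℤ)) :
    (Fin g → ℤ) × (Fin g → ℤ) :=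
  (fun i => x.2.1 i + x.2.2 i + (((x.1 + ε) i).val + (x.1 i).val - (ε i).val) / 2,
    fun i => x.2.1 i - x.2.2 i + (((x.1 + ε) i).val - (x.1 i).val - (ε i).val) / 2)

/-- Since `m - n = 2 l + α`, the parity of `m - n` determines `α`, and then `l` and `k` follow. The
halved quantities are always even, so integer division is exact. -/
theorem additionIndex_bijective (ε : HalfChar g) : Function.Bijective (additionIndex ε) := by
  have h2 : ∀ x : ZMod 2, x = 0 ∨ x = 1 := by decide
  have v0 : ZMod.val (0 : ZMod 2) = 0 := rfl
  have v1 : ZMod.val (1 : ZMod 2) = 1 := rfl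
  have v2 : ZMod.val (1 + 1 : ZMod 2) = 0 := rfl
  constructor
  · rintro ⟨α, k, l⟩ ⟨α', k', l'⟩ h
    have key : ∀ i, α i = α' i ∧ k i = k' i ∧ l i = l' i := by
      intro i
      have h1 := congrFun (congrArg Prod.fst h) i
      have h3 := congrFun (congrArg Prod.snd h) i
      simp only [additionIndex, Pi.add_apply] at h1 h3
      rcases h2 (α i) with ha | ha <;> rcases h2 (α' i) with ha' | ha' <;>
        rcases h2 (ε i) with he | he <;>
        simp only [ha, ha', he, v0, v1, v2, add_zero, zero_add] at h1 h3 ⊢ <;>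
        simp <;> omega
    exact Prod.ext (funext fun i => (key i).1)
      (Prod.ext (funext fun i => (key i).2.1) (funext fun i => (key i).2.2))
  · rintro ⟨m, n⟩
    have key : ∀ i, ∃ (a : ZMod 2) (k l : ℤ),
        k + l + ((a + ε i).val + a.val - (ε i).val) / 2 = m i ∧
        k - l + ((a + ε i).val - a.val - (ε i).val) / 2 = n i := by
      intro i
      rcases Int.even_or_odd' (m i - n i) with ⟨c, hc | hc⟩
      · refine ⟨0, m i - c, c, ?_⟩
        rcases h2 (ε i) with he | he <;>
          simp [he, v0, v1] <;> omega
      · rcases h2 (ε i) with he | he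
        · refine ⟨1, m i - c - 1, c, ?_⟩
          simp [he, v0, v1]; omega
        · refine ⟨1, m i - c, c, ?_⟩
          simp [he, v1, v2]; omega
    choose a k l h using key
    exact ⟨(a, k, l), Prod.ext (funext fun i => (h i).1) (funext fun i => (h i).2)⟩

theorem thetaPoint_additionIndex (ε : HalfChar g)
    (x : HalfChar g × (Fin g → ℤ) × (Fin g → ℤ)) :
    thetaPoint ε (additionIndex ε x).1 = thetaPoint (x.1 + ε) x.2.1 + thetaPoint x.1 x.2.2 ∧
    thetaPoint ε (additionIndex ε x).2 = thetaPoint (x.1 + ε) x.2.1 - thetaPoint x.1 x.2.2 := by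
  have h2 : ∀ x : ZMod 2, x = 0 ∨ x = 1 := by decide
  have v0 : ZMod.val (0 : ZMod 2) = 0 := rfl
  have v1 : ZMod.val (1 : ZMod 2) = 1 := rfl
  have v2 : ZMod.val (1 + 1 : ZMod 2) = 0 := rfl
  constructor <;>
  · funext i
    simp only [thetaPoint, additionIndex, HalfChar.toComplex, Pi.add_apply, Pi.sub_apply,
      Pi.smul_apply, smul_eq_mul]
    rcases h2 (x.1 i) with ha | ha <;> rcases h2 (ε i) with he | he <;>
      simp only [ha, he, v0, v1, v2, add_zero, zero_add] <;> norm_num <;> ring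

theorem expDecay_secondOrderTheta (τ : SiegelUpperHalfSpace g) (ε : HalfChar g) :
    ExpDecay (thetaCoeff ε 0 ((2 : ℂ) • τ.1)) (thetaFreq 2 ε) := by
  refine expDecay_theta 2 ε 0 ?_
  have : ((2 : ℂ) • τ.1).map Complex.im = (2 : ℝ) • τ.1.map Complex.im := by
    ext i j; simp
  rw [this]
  exact τ.2.2.smul two_pos

/-- Riemann's addition formula for theta functions of the second order. -/
theorem theta_add_mul_theta_sub (τ : SiegelUpperHalfSpace g) (ε σ : HalfChar g)
    (z w : Fin g → ℂ) :
    theta ε σ τ.1 (z + w) * theta ε σ τ.1 (z - w) =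
      ∑ α, pairingSign (α + ε) σ * (secondOrderTheta (α + ε) τ z * secondOrderTheta α τ w) := by
  have hτ := expDecay_theta 1 ε σ τ.2.2
  have h2τ := expDecay_secondOrderTheta τ
  have hth : ∀ y, theta ε σ τ.1 y = expSeries (thetaCoeff ε σ τ.1) (thetaFreq 1 ε) y := fun y => by
    rw [← theta_smul_eq_expSeries, one_smul]
  simp only [secondOrderTheta, thetaDouble, theta_smul_eq_expSeries, hth]
  have hsum := summable_mul_of_summable_norm (hτ.summable_norm (z + w)) (hτ.summable_norm (z - w))
  rw [expSeries, expSeries, tsum_mul_tsum_of_summable_norm (hτ.summable_norm _)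
    (hτ.summable_norm _), ← (Equiv.ofBijective _ (additionIndex_bijective ε)).tsum_eq]
  rw [← (Equiv.ofBijective _ (additionIndex_bijective ε)).summable_iff] at hsum
  have hterm : ∀ x, thetaCoeff ε σ τ.1 (additionIndex ε x).1 *
        Complex.exp (thetaFreq 1 ε (additionIndex ε x).1 ⬝ᵥ (z + w)) *
        (thetaCoeff ε σ τ.1 (additionIndex ε x).2 *
          Complex.exp (thetaFreq 1 ε (additionIndex ε x).2 ⬝ᵥ (z - w))) =
      pairingSign (x.1 + ε) σ * (thetaCoeff (x.1 + ε) 0 ((2 : ℂ) • τ.1) x.2.1 *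
        Complex.exp (thetaFreq 2 (x.1 + ε) x.2.1 ⬝ᵥ z) *
        (thetaCoeff x.1 0 ((2 : ℂ) • τ.1) x.2.2 *
          Complex.exp (thetaFreq 2 x.1 x.2.2 ⬝ᵥ w))) := by
    intro x
    obtain ⟨h1, h2⟩ := thetaPoint_additionIndex ε x
    have h0 : (0 : HalfChar g).toComplex = 0 := by funext i; simp [HalfChar.toComplex]
    rw [← exp_two_mul_thetaPoint (x.1 + ε) σ x.2.1]
    simp only [thetaCoeff, thetaFreq, h1, h2, h0, ← Complex.exp_add]
    congr 1
    simp only [Matrix.mulVec_add, Matrix.mulVec_sub, dotProduct_add, add_dotProduct,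
      sub_dotProduct, dotProduct_sub, smul_dotProduct, smul_eq_mul, Matrix.smul_mulVec,
      dotProduct_smul, dotProduct_zero]
    ring
  simp only [Function.comp_def, Equiv.ofBijective_apply, hterm] at hsum ⊢
  rw [hsum.tsum_prod, tsum_fintype]
  refine Finset.sum_congr rfl fun α _ => ?_
  dsimp only
  rw [expSeries, expSeries, tsum_mul_tsum_of_summable_norm
    ((h2τ _).summable_norm _) ((h2τ _).summable_norm _)]
  exact tsum_mul_left

end ThetaFunction

/-! ### Characters of `(ℤ/2)^g`. -/

section PairingSign

variable {g : ℕ}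

theorem neg_one_pow_val_add (a b : ZMod 2) :
    (-1 : ℂ) ^ (a + b).val = (-1) ^ a.val * (-1) ^ b.val := by
  have h2 : ∀ x : ZMod 2, x = 0 ∨ x = 1 := by decide
  have v0 : ZMod.val (0 : ZMod 2) = 0 := rfl
  have v1 : ZMod.val (1 : ZMod 2) = 1 := rfl
  have v2 : ZMod.val (1 + 1 : ZMod 2) = 0 := rfl
  rcases h2 a with rfl | rfl <;> rcases h2 b with rfl | rfl <;> simp [v0, v1, v2]

theorem pairingSign_add_left (α β σ : HalfChar g) :
    pairingSign (α + β) σ = pairingSign α σ * pairingSign β σ := by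
  simp only [pairingSign, add_dotProduct, neg_one_pow_val_add]

theorem pairingSign_add_right (α σ ρ : HalfChar g) :
    pairingSign α (σ + ρ) = pairingSign α σ * pairingSign α ρ := by
  simp only [pairingSign, dotProduct_add, neg_one_pow_val_add]

theorem pairingSign_eq_neg_one {α σ : HalfChar g} (h : α ⬝ᵥ σ = 1) : pairingSign α σ = -1 := by
  rw [pairingSign, h]; exact pow_one _

theorem pairingSign_eq_one {α σ : HalfChar g} (h : α ⬝ᵥ σ ≠ 1) : pairingSign α σ = 1 := by
  have h2 : ∀ x : ZMod 2, x ≠ 1 → x = 0 := by decide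
  rw [pairingSign, h2 _ h]; exact pow_zero _

theorem HalfChar.add_self (α : HalfChar g) : α + α = 0 :=
  funext fun i => CharTwo.add_self_eq_zero (α i)

theorem HalfChar.add_add_cancel (α β : HalfChar g) : α + β + β = α := by
  rw [add_assoc, HalfChar.add_self, add_zero]

theorem sum_pairingSign (α : HalfChar g) :
    ∑ σ, pairingSign α σ = if α = 0 then 2 ^ g else 0 := by
  split_ifs with h
  · subst h
    have : ∀ σ : HalfChar g, pairingSign 0 σ = 1 := fun σ =>
      pairingSign_eq_one (by rw [zero_dotProduct]; decide)
    simp [this, ZMod.card]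
  · obtain ⟨i, hi⟩ := Function.ne_iff.1 h
    have h2 : ∀ x : ZMod 2, x ≠ 0 → x = 1 := by decide
    -- Translating `σ` by `e_i` with `α_i = 1` negates the sum.
    have h1 : pairingSign α (Pi.single i 1) = -1 :=
      pairingSign_eq_neg_one (by rw [dotProduct_single, mul_one]; exact h2 _ hi)
    have := Equiv.sum_comp (Equiv.addRight (Pi.single i 1 : HalfChar g)) (pairingSign α)
    simp only [Equiv.coe_addRight, pairingSign_add_right, h1, mul_neg, mul_one,
      Finset.sum_neg_distrib] at this
    linear_combination -(1 / 2 : ℂ) * this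

theorem sum_pairingSign_mul_sum (F : HalfChar g → ℂ) (α : HalfChar g) :
    ∑ σ, pairingSign α σ * ∑ β, pairingSign β σ * F β = 2 ^ g * F α := by
  simp only [Finset.mul_sum]
  rw [Finset.sum_comm]
  have h : ∀ β, ∑ σ, pairingSign α σ * (pairingSign β σ * F β) =
      if α = β then 2 ^ g * F β else 0 := by
    intro β
    have : α + β = 0 ↔ α = β :=
      ⟨fun h => by rw [← HalfChar.add_add_cancel α β, h, zero_add],
        fun h => by rw [h, HalfChar.add_self]⟩
    simp only [← mul_assoc, ← pairingSign_add_left, ← Finset.sum_mul, sum_pairingSign, this]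
    split_ifs <;> simp
  simp [h]

end PairingSign

/-! ### Theta constants, and the minors `A` through odd gradients. -/

section ThetaConstants

variable {g : ℕ}

theorem ExpDecay.hasDerivAt_sub {ι : Type*} {a : ι → ℂ} {lam : ι → Fin g → ℂ}
    (h : ExpDecay a lam) (z v : Fin g → ℂ) (t : ℂ) :
    HasDerivAt (fun s : ℂ => expSeries a lam (z - s • v))
      (-expSeries (_root_.dirCoeff lam v a) lam (z - t • v)) t := by
  have := (h.hasDerivAt z v (-t)).scomp t (hasDerivAt_neg t)
  simp only [neg_smul, ← sub_eq_add_neg, one_smul] at this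
  exact this.congr_of_eventuallyEq (.of_forall fun s => by
    simp [sub_eq_add_neg])

/-- Differentiating twice an expansion of `f²`. -/
theorem sum_mul_expSeries_dirCoeff_of_sq_eq {ι κ : Type*} [Fintype κ] {a : ι → ℂ}
    {lam : ι → Fin g → ℂ} {b : κ → ι → ℂ} {mu : κ → ι → Fin g → ℂ} {c : κ → ℂ}
    (ha : ExpDecay a lam) (hb : ∀ k, ExpDecay (b k) (mu k))
    (h : ∀ z, expSeries a lam z ^ 2 = ∑ k, c k * expSeries (b k) (mu k) z) (v w z : Fin g → ℂ) :
    ∑ k, c k * expSeries (dirCoeff (mu k) v (dirCoeff (mu k) w (b k))) (mu k) z =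
      2 * (expSeries (dirCoeff lam v a) lam z * expSeries (dirCoeff lam w a) lam z +
        expSeries a lam z * expSeries (dirCoeff lam v (dirCoeff lam w a)) lam z) := by
  have h1 : ∀ z, ∑ k, c k * expSeries (dirCoeff (mu k) w (b k)) (mu k) z =
      2 * (expSeries a lam z * expSeries (dirCoeff lam w a) lam z) := by
    intro z
    have e1 := HasDerivAt.fun_sum (u := Finset.univ)
      fun k _ => ((hb k).hasDerivAt z w 0).const_mul (c k)
    have e2 := (ha.hasDerivAt z w 0).fun_pow 2
    simp only [← h] at e1
    have := e1.unique e2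
    simp only [zero_smul, add_zero] at this
    rw [this]; push_cast; ring
  have e1 := HasDerivAt.fun_sum (u := Finset.univ)
      fun k _ => (((hb k).dirCoeff w).hasDerivAt z v 0).const_mul (c k)
  have e2 := ((ha.hasDerivAt z v 0).fun_mul ((ha.dirCoeff w).hasDerivAt z v 0)).const_mul 2
  simp only [h1] at e1
  have := e1.unique e2
  simp only [zero_smul, add_zero] at this
  rw [this]

/-- Differentiating twice at `w = 0` an expansion of `f (z + w) f (z - w)`. -/
theorem sum_mul_expSeries_dirCoeff_of_mul_eq {ι κ : Type*} [Fintype κ] {a : ι → ℂ}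
    {lam : ι → Fin g → ℂ} {b : κ → ι → ℂ} {mu : κ → ι → Fin g → ℂ} {c : κ → ℂ} {z : Fin g → ℂ}
    (ha : ExpDecay a lam) (hb : ∀ k, ExpDecay (b k) (mu k))
    (h : ∀ w, expSeries a lam (z + w) * expSeries a lam (z - w) =
      ∑ k, c k * expSeries (b k) (mu k) w) (u v : Fin g → ℂ) :
    ∑ k, c k * expSeries (dirCoeff (mu k) u (dirCoeff (mu k) v (b k))) (mu k) 0 =
      2 * (expSeries a lam z * expSeries (dirCoeff lam u (dirCoeff lam v a)) lam z -
        expSeries (dirCoeff lam v a) lam z * expSeries (dirCoeff lam u a) lam z) := by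
  have h1 : ∀ w, ∑ k, c k * expSeries (dirCoeff (mu k) v (b k)) (mu k) w =
      expSeries (dirCoeff lam v a) lam (z + w) * expSeries a lam (z - w) -
        expSeries a lam (z + w) * expSeries (dirCoeff lam v a) lam (z - w) := by
    intro w
    have e1 := HasDerivAt.fun_sum (u := Finset.univ)
      fun k _ => ((hb k).hasDerivAt w v 0).const_mul (c k)
    have e2 := (ha.hasDerivAt (z + w) v 0).fun_mul (ha.hasDerivAt_sub (z - w) v 0)
    simp only [← h, ← add_assoc, ← sub_sub] at e1
    have := e1.unique e2
    simp only [zero_smul, add_zero, sub_zero] at this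
    rw [this]; ring
  have e1 := HasDerivAt.fun_sum (u := Finset.univ)
      fun k _ => (((hb k).dirCoeff v).hasDerivAt 0 u 0).const_mul (c k)
  have e2 := (((ha.dirCoeff v).hasDerivAt z u 0).fun_mul (ha.hasDerivAt_sub z u 0)).fun_sub
    ((ha.hasDerivAt z u 0).fun_mul ((ha.dirCoeff v).hasDerivAt_sub z u 0))
  simp only [h1, zero_add] at e1
  have := e1.unique e2
  simp only [zero_smul, add_zero, sub_zero] at this
  rw [this]; ring

/-- The Hessian form at `z = 0` of the second order theta function `Θ[ε]`. -/
noncomputable def thetaHessian (τ : SiegelUpperHalfSpace g) (v w : Fin g → ℂ) (ε : HalfChar g) :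
    ℂ :=
  expSeries (dirCoeff (thetaFreq 2 ε) v (dirCoeff (thetaFreq 2 ε) w
    (thetaCoeff ε 0 ((2 : ℂ) • τ.1)))) (thetaFreq 2 ε) 0

theorem theta_eq_expSeries (τ : SiegelUpperHalfSpace g) (ε σ : HalfChar g) :
    theta ε σ τ.1 = expSeries (thetaCoeff ε σ τ.1) (thetaFreq 1 ε) :=
  funext fun y => by rw [← theta_smul_eq_expSeries, one_smul]

theorem secondOrderTheta_eq_expSeries (τ : SiegelUpperHalfSpace g) (ε : HalfChar g) :
    secondOrderTheta ε τ =
      expSeries (thetaCoeff ε 0 ((2 : ℂ) • τ.1)) (thetaFreq 2 ε) :=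
  funext fun _ => theta_smul_eq_expSeries _ _ _ _ _

theorem thetaA_eq (τ : SiegelUpperHalfSpace g) (i j : Fin g) (ε δ : HalfChar g) :
    thetaA 0 τ i j ε δ =
      thetaHessian τ (Pi.single i 1) (Pi.single j 1) δ * secondOrderThetaConstants τ ε -
        secondOrderThetaConstants τ δ * thetaHessian τ (Pi.single i 1) (Pi.single j 1) ε := by
  have h : ∀ ε, partialDeriv i (partialDeriv j (thetaDouble ε 0 τ)) 0 =
      thetaHessian τ (Pi.single i 1) (Pi.single j 1) ε := fun ε => by
    rw [show thetaDouble ε 0 τ = _ from secondOrderTheta_eq_expSeries τ ε,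
      (expDecay_secondOrderTheta τ ε).partialDeriv,
      ((expDecay_secondOrderTheta τ ε).dirCoeff _).partialDeriv]
    rfl
  rw [thetaA, h, h]; rfl

theorem thetaGradient_eq (τ : SiegelUpperHalfSpace g) (ε σ : HalfChar g) (i : Fin g) :
    thetaGradient τ ε σ i = expSeries (dirCoeff (thetaFreq 1 ε) (Pi.single i 1)
      (thetaCoeff ε σ τ.1)) (thetaFreq 1 ε) 0 := by
  rw [thetaGradient, theta_eq_expSeries, (expDecay_theta 1 ε σ τ.2.2).partialDeriv]

theorem thetaHessian_eq_sum (τ : SiegelUpperHalfSpace g) (v w : Fin g → ℂ) (ε : HalfChar g) :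
    thetaHessian τ v w ε =
      ∑ i, ∑ j, v i * w j * thetaHessian τ (Pi.single i 1) (Pi.single j 1) ε :=
  (expDecay_secondOrderTheta τ ε).expSeries_dirCoeff_dirCoeff v w 0

theorem thetaC_zero (τ : SiegelUpperHalfSpace g) (i j : Fin g) (ε σ : HalfChar g) :
    thetaC 0 τ i j ε σ = 2 * (thetaGradient τ ε σ i * thetaGradient τ ε σ j) := by
  rw [thetaC, zero_add]; ring

theorem exists_theta_ne_zero (τ : SiegelUpperHalfSpace g) : ∃ z, theta 0 0 τ.1 z ≠ 0 := by
  rw [theta_eq_expSeries]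
  refine exists_expSeries_ne_zero ?_ (Complex.exp_ne_zero _)
  simpa using (expDecay_theta 1 0 0 τ.2.2).summable_norm 0

theorem theta_mul_self (τ : SiegelUpperHalfSpace g) (ε σ : HalfChar g) (z : Fin g → ℂ) :
    theta ε σ τ.1 z ^ 2 = ∑ α, pairingSign (α + ε) σ * secondOrderThetaConstants τ α *
      secondOrderTheta (α + ε) τ z := by
  have := theta_add_mul_theta_sub τ ε σ z 0
  rw [add_zero, sub_zero, ← sq] at this
  rw [this]
  exact Finset.sum_congr rfl fun α _ => by rw [secondOrderThetaConstants]; ring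

theorem secondOrderThetaConstants_ne_zero (τ : SiegelUpperHalfSpace g) :
    secondOrderThetaConstants τ ≠ 0 := by
  intro h
  obtain ⟨z, hz⟩ := exists_theta_ne_zero τ
  have := theta_mul_self τ 0 0 z
  simp only [h, Pi.zero_apply, mul_zero, zero_mul, Finset.sum_const_zero] at this
  exact hz (pow_eq_zero_iff two_ne_zero |>.1 this)

theorem sum_add_right (ε : HalfChar g) (F : HalfChar g → ℂ) : ∑ α, F (α + ε) = ∑ α, F α :=
  Equiv.sum_comp (Equiv.addRight ε) F

/-- In the expansion of `θ²` at zero, exchanging `α` with `α + ε` flips the sign of each term. -/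
theorem theta_zero_of_odd (τ : SiegelUpperHalfSpace g) {ε σ : HalfChar g} (h : ε ⬝ᵥ σ = 1) :
    theta ε σ τ.1 0 = 0 := by
  have h1 := theta_mul_self τ ε σ 0
  have h2 := h1
  rw [← sum_add_right ε] at h2
  simp only [HalfChar.add_add_cancel, pairingSign_add_left, pairingSign_eq_neg_one h] at h1 h2
  rw [← sq_eq_zero_iff]
  have h3 : theta ε σ τ.1 0 ^ 2 + theta ε σ τ.1 0 ^ 2 = 0 := by
    nth_rewrite 1 [h1]
    rw [h2, ← Finset.sum_add_distrib]
    refine Finset.sum_eq_zero fun α _ => ?_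
    simp only [secondOrderThetaConstants]; ring
  linear_combination (1 / 2 : ℂ) * h3

/-- Because `θ` vanishes at zero, the second derivative of `θ²` there is a pure product of
gradients. Adding the expansion to its copy under `α ↦ α + ε`, where the sign flips, assembles the
minors. -/
theorem sum_pairingSign_mul_thetaA_of_odd (τ : SiegelUpperHalfSpace g) (i j : Fin g)
    {ε σ : HalfChar g} (h : ε ⬝ᵥ σ = 1) :
    ∑ α, pairingSign α σ * thetaA 0 τ i j (α + ε) α = 2 * thetaC 0 τ i j ε σ := by
  have h1 := sum_mul_expSeries_dirCoeff_of_sq_eq (expDecay_theta 1 ε σ τ.2.2)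
    (fun α => expDecay_secondOrderTheta τ (α + ε))
    (c := fun α => pairingSign (α + ε) σ * secondOrderThetaConstants τ α)
    (fun z => by
      rw [← theta_eq_expSeries, theta_mul_self]
      exact Finset.sum_congr rfl fun α _ => by rw [secondOrderTheta_eq_expSeries])
    (Pi.single i 1) (Pi.single j 1) 0
  rw [← theta_eq_expSeries, theta_zero_of_odd τ h, zero_mul, add_zero, ← thetaGradient_eq,
    ← thetaGradient_eq, ← thetaC_zero] at h1
  change ∑ α, pairingSign (α + ε) σ * secondOrderThetaConstants τ α *
    thetaHessian τ (Pi.single i 1) (Pi.single j 1) (α + ε) = _ at h1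
  have h2 := h1
  rw [← sum_add_right ε] at h2
  simp only [HalfChar.add_add_cancel, pairingSign_add_left, pairingSign_eq_neg_one h] at h1 h2
  rw [two_mul]
  nth_rewrite 1 [← h1]
  rw [← h2, ← Finset.sum_add_distrib]
  refine Finset.sum_congr rfl fun α _ => ?_
  rw [thetaA_eq]; ring

/-- Here `α ↦ α + ε` keeps the sign, while `A` is antisymmetric. -/
theorem sum_pairingSign_mul_thetaA_of_even (τ : SiegelUpperHalfSpace g) (i j : Fin g)
    {ε σ : HalfChar g} (h : ε ⬝ᵥ σ ≠ 1) :
    ∑ α, pairingSign α σ * thetaA 0 τ i j (α + ε) α = 0 := by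
  have h1 := sum_add_right ε fun α => pairingSign α σ * thetaA 0 τ i j (α + ε) α
  simp only [HalfChar.add_add_cancel, pairingSign_add_left, pairingSign_eq_one h, mul_one] at h1
  have h2 : ∀ α, thetaA 0 τ i j α (α + ε) = -thetaA 0 τ i j (α + ε) α := fun α => by
    rw [thetaA_eq, thetaA_eq]; ring
  simp only [h2, mul_neg, Finset.sum_neg_distrib] at h1
  linear_combination -(1 / 2 : ℂ) * h1

/-- The `2 × 2` minors `A` in terms of the odd theta gradients. -/
theorem thetaA_eq_sum_thetaC (hg : 1 ≤ g) (τ : SiegelUpperHalfSpace g) (i j : Fin g)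
    (α ε : HalfChar g) :
    thetaA 0 τ i j (α + ε) α =
      1 / 2 ^ (g - 1) *
        ∑ σ : HalfChar g with ε ⬝ᵥ σ = 1, pairingSign α σ * thetaC 0 τ i j ε σ := by
  have h1 := sum_pairingSign_mul_sum (fun β => thetaA 0 τ i j (β + ε) β) α
  have h2 : ∀ σ, pairingSign α σ * ∑ β, pairingSign β σ * thetaA 0 τ i j (β + ε) β =
      2 * if ε ⬝ᵥ σ = 1 then pairingSign α σ * thetaC 0 τ i j ε σ else 0 := by
    intro σ
    split_ifs with h
    · rw [sum_pairingSign_mul_thetaA_of_odd τ i j h]; ring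
    · rw [sum_pairingSign_mul_thetaA_of_even τ i j h]; ring
  simp only [h2, ← Finset.mul_sum, ← Finset.sum_filter] at h1
  have hg' : (2 : ℂ) ^ g = 2 * 2 ^ (g - 1) := by
    rw [← pow_succ', Nat.sub_add_cancel hg]
  rw [hg', mul_assoc] at h1
  rw [mul_left_cancel₀ two_ne_zero h1, ← mul_assoc, one_div,
    inv_mul_cancel₀ (pow_ne_zero _ two_ne_zero), one_mul]

end ThetaConstants

/-! ### Spanning by odd gradients, and uniqueness of the solution. -/

section Reconstruction

variable {g : ℕ}

/-- Where `θ ≠ 0`, the left side is `2 θ² ∂_w∂_v log θ`. -/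
theorem theta_mul_hessian_sub (τ : SiegelUpperHalfSpace g) (v w z : Fin g → ℂ) :
    2 * (expSeries (thetaCoeff 0 0 τ.1) (thetaFreq 1 0) z *
          expSeries (dirCoeff (thetaFreq 1 0) w (dirCoeff (thetaFreq 1 0) v (thetaCoeff 0 0 τ.1)))
            (thetaFreq 1 0) z -
        expSeries (dirCoeff (thetaFreq 1 0) v (thetaCoeff 0 0 τ.1)) (thetaFreq 1 0) z *
          expSeries (dirCoeff (thetaFreq 1 0) w (thetaCoeff 0 0 τ.1)) (thetaFreq 1 0) z) =
      ∑ α, secondOrderTheta α τ z * thetaHessian τ w v α := by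
  refine (sum_mul_expSeries_dirCoeff_of_mul_eq (expDecay_theta 1 0 0 τ.2.2)
    (expDecay_secondOrderTheta τ) (c := fun α => secondOrderTheta α τ z) (fun y => ?_) w v).symm
  rw [← theta_eq_expSeries, theta_add_mul_theta_sub]
  refine Finset.sum_congr rfl fun α _ => ?_
  rw [pairingSign_eq_one (by rw [dotProduct_zero]; decide), one_mul, add_zero,
    ← secondOrderTheta_eq_expSeries]

/-- The Hessian is proportional to the theta constants in directions orthogonal to all odd theta
gradients. -/
theorem exists_thetaHessian_eq_mul (hg : 1 ≤ g) (τ : SiegelUpperHalfSpace g) {v : Fin g → ℂ}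
    (hv : ∀ ε σ : HalfChar g, ε ⬝ᵥ σ = 1 → v ⬝ᵥ thetaGradient τ ε σ = 0) (w : Fin g → ℂ) :
    ∃ c, ∀ δ, thetaHessian τ w v δ = c * secondOrderThetaConstants τ δ := by
  have hA : ∀ β δ : HalfChar g, ∑ i, ∑ j, w i * v j * thetaA 0 τ i j (δ + β) δ = 0 := by
    intro β δ
    refine Finset.sum_eq_zero fun i _ => ?_
    simp only [thetaA_eq_sum_thetaC hg, Finset.mul_sum]
    rw [Finset.sum_comm]
    refine Finset.sum_eq_zero fun σ hσ => ?_
    have := hv _ _ (Finset.mem_filter.1 hσ).2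
    rw [dotProduct] at this
    calc _ = (w i * (1 / 2 ^ (g - 1)) * pairingSign δ σ * 2 * thetaGradient τ β σ i) *
          ∑ j, v j * thetaGradient τ β σ j := by
          rw [Finset.mul_sum]
          exact Finset.sum_congr rfl fun j _ => by rw [thetaC_zero]; ring
      _ = 0 := by rw [this, mul_zero]
  obtain ⟨ε, hε⟩ := Function.ne_iff.1 (secondOrderThetaConstants_ne_zero τ)
  refine ⟨thetaHessian τ w v ε / secondOrderThetaConstants τ ε, fun δ => ?_⟩
  have h := hA (δ + ε) δ
  rw [← add_assoc, HalfChar.add_self, zero_add] at h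
  have h1 : ∑ i, ∑ j, w i * v j * thetaA 0 τ i j ε δ =
      thetaHessian τ w v δ * secondOrderThetaConstants τ ε -
        secondOrderThetaConstants τ δ * thetaHessian τ w v ε := by
    rw [thetaHessian_eq_sum τ w v δ, thetaHessian_eq_sum τ w v ε]
    simp only [Finset.mul_sum, Finset.sum_mul, ← Finset.sum_sub_distrib]
    exact Finset.sum_congr rfl fun i _ => Finset.sum_congr rfl fun j _ => by
      rw [thetaA_eq]; ring
  rw [h1] at h
  have hε' : secondOrderThetaConstants τ ε ≠ 0 := hε
  field_simp
  linear_combination h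

/-- No nonzero direction is orthogonal to all odd theta gradients. -/
theorem eq_zero_of_forall_dotProduct_thetaGradient_eq_zero (hg : 1 ≤ g)
    (τ : SiegelUpperHalfSpace g) {v : Fin g → ℂ}
    (hv : ∀ ε σ : HalfChar g, ε ⬝ᵥ σ = 1 → v ⬝ᵥ thetaGradient τ ε σ = 0) : v = 0 := by
  set a := thetaCoeff 0 0 τ.1
  set lam : (Fin g → ℤ) → Fin g → ℂ := thetaFreq 1 0
  have ha : ExpDecay a lam := expDecay_theta 1 0 0 τ.2.2
  obtain ⟨z, hz⟩ := exists_theta_ne_zero τ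
  replace hz : expSeries a lam z ≠ 0 := by rwa [theta_eq_expSeries] at hz
  -- On the line `z + t w` the Wronskian of `θ` and `∂_v θ` is `(c/2) θ²`; the conclusion is taken
  -- at `t = 1`.
  have hline : ∀ (w : Fin g → ℂ) (c : ℂ),
      (∀ δ, thetaHessian τ w v δ = c * secondOrderThetaConstants τ δ) →
      expSeries (dirCoeff lam v a) lam (z + w) =
        (c / 2 + expSeries (dirCoeff lam v a) lam z / expSeries a lam z) *
          expSeries a lam (z + w) := by
    intro w c hc
    have := eq_affine_mul_of_wronskian_eq (c := c / 2) (fun t => ha.hasDerivAt z w t)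
      (fun t => (ha.dirCoeff v).hasDerivAt z w t) (by simpa using hz) (fun t => ?_) 1
    · simpa using this
    · have h1 := theta_mul_hessian_sub τ v w (z + t • w)
      have h2 := theta_mul_self τ 0 0 (z + t • w)
      rw [theta_eq_expSeries] at h2
      simp only [hc] at h1
      have h3 : ∑ α, secondOrderTheta α τ (z + t • w) * (c * secondOrderThetaConstants τ α) =
          c * expSeries a lam (z + t • w) ^ 2 := by
        rw [h2, Finset.mul_sum]
        refine Finset.sum_congr rfl fun α _ => ?_
        rw [pairingSign_eq_one (by rw [dotProduct_zero]; decide), add_zero]; ring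
      rw [h3] at h1
      linear_combination (1 / 2 : ℂ) * h1
  -- Both `θ` and `∂_v θ` have period `e_k`, so the affine increment `c / 2` is zero.
  have hsingle : ∀ k δ, thetaHessian τ (Pi.single k 1) v δ = 0 := by
    intro k δ
    obtain ⟨c, hc⟩ := exists_thetaHessian_eq_mul hg τ hv (Pi.single k 1)
    have h1 := hline _ c hc
    rw [show expSeries (dirCoeff lam v a) lam (z + Pi.single k 1) = _ from
        expSeries_add_int _ k z,
      show expSeries a lam (z + Pi.single k 1) = _ from expSeries_add_int a k z] at h1
    change expSeries (dirCoeff lam v a) lam z = _ * expSeries a lam z at h1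
    have h2 : c = 0 := by
      have : c * expSeries a lam z = 0 := by
        rw [add_mul, div_mul_cancel₀ _ hz] at h1
        linear_combination -2 * h1
      exact (mul_eq_zero.1 this).resolve_right hz
    rw [hc, h2, zero_mul]
  have hall : ∀ w δ, thetaHessian τ w v δ = 0 * secondOrderThetaConstants τ δ := by
    intro w δ
    rw [zero_mul, thetaHessian, ((expDecay_secondOrderTheta τ δ).dirCoeff v).expSeries_dirCoeff]
    exact Finset.sum_eq_zero fun k _ => by
      rw [show expSeries _ _ _ = _ from hsingle k δ, mul_zero]
  funext k
  have h1 := hline (τ.1 *ᵥ Pi.single k 1) 0 (hall _)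
  have hf := expSeries_add_tau τ.2.1 (fun _ => 1) k z
  have hh := expSeries_add_tau τ.2.1 (fun n => lam n ⬝ᵥ v) k z
  -- Under `τ e_k` the logarithmic derivative `∂_v θ / θ` changes by `-2πi v_k`, whereas vanishing
  -- of the Hessians leaves it unchanged.
  have hshift : expSeries (fun n => (lam (n - Pi.single k 1) ⬝ᵥ v) * a n) lam z =
      expSeries (dirCoeff lam v a) lam z - 2 * Real.pi * Complex.I * v k * expSeries a lam z := by
    rw [expSeries, expSeries, expSeries, ← tsum_mul_left,
      ← Summable.tsum_sub ((ha.dirCoeff v).summable z) ((ha.summable z).mul_left _)]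
    refine tsum_congr fun n => ?_
    have : lam (n - Pi.single k 1) = lam n - (2 * Real.pi * Complex.I) • Pi.single k 1 := by
      funext i
      by_cases h : i = k
      · subst h; simp [lam, thetaFreq, thetaPoint, HalfChar.toComplex]; ring
      · simp [lam, thetaFreq, thetaPoint, HalfChar.toComplex, h]
    rw [this, dirCoeff, sub_dotProduct, smul_dotProduct, single_dotProduct, smul_eq_mul, one_mul]
    ring
  simp only [one_mul] at hf
  change expSeries (dirCoeff lam v a) lam _ = _ * expSeries (fun n =>
    (lam (n - Pi.single k 1) ⬝ᵥ v) * a n) lam z at hh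
  change expSeries a lam _ = _ * expSeries a lam z at hf
  rw [hh, hf, hshift, zero_div, zero_add] at h1
  have he := Complex.exp_ne_zero (-(Real.pi * Complex.I * (τ.1 k k + 2 * z k)))
  have h2 : Complex.exp (-(Real.pi * Complex.I * (τ.1 k k + 2 * z k))) *
      (2 * Real.pi * Complex.I * expSeries a lam z) * v k = 0 := by
    rw [mul_left_comm, div_mul_cancel₀ _ hz] at h1
    linear_combination -h1
  refine (mul_eq_zero.1 h2).resolve_left (mul_ne_zero he (mul_ne_zero ?_ hz))
  exact Complex.two_pi_I_ne_zero

/-- Each equation is a `3 × 3` determinant with two proportional rows. -/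
theorem secondOrderThetaConstants_solves (τ : SiegelUpperHalfSpace g) (a : ℂ) :
    SolvesThreeTermSystem (thetaA 0 τ) (a • secondOrderThetaConstants τ) := by
  intro i j ε δ σ
  simp only [thetaA_eq, Pi.smul_apply, smul_eq_mul]
  ring

theorem exists_smul_eq_of_solves (hg : 2 ≤ g) (τ : SiegelUpperHalfSpace g)
    {x : HalfChar g → ℂ} (hx : SolvesThreeTermSystem (thetaA 0 τ) x) :
    ∃ a : ℂ, a • secondOrderThetaConstants τ = x := by
  by_contra! hne
  set T := secondOrderThetaConstants τ with hT
  obtain ⟨ε₀, hε₀⟩ : ∃ ε, T ε ≠ 0 := Function.ne_iff.1 (secondOrderThetaConstants_ne_zero τ)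
  obtain ⟨δ₀, hδ₀⟩ := Function.ne_iff.1 (hne (x ε₀ / T ε₀))
  set m := x δ₀ * T ε₀ - x ε₀ * T δ₀ with hm
  have hm0 : m ≠ 0 := by
    intro h
    apply hδ₀
    rw [Pi.smul_apply, smul_eq_mul]
    field_simp
    linear_combination -h
  set s : Fin g → Fin g → ℂ := fun i j => thetaA 0 τ i j ε₀ δ₀ with hs
  -- The equations put the Hessian vector in the span of `x` and `T`, so its wedge with `T` is a
  -- multiple of `x ∧ T`; `m` is the nonzero coordinate of `x ∧ T` at `ε₀, δ₀`.
  have hA : ∀ i j ρ σ, m * thetaA 0 τ i j ρ σ = s i j * (x σ * T ρ - x ρ * T σ) := by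
    intro i j ρ σ
    have h1 := hx i j ε₀ δ₀ σ
    have h2 := hx i j ε₀ δ₀ ρ
    simp only [hs, hm]
    simp only [thetaA_eq, ← hT] at h1 h2 ⊢
    linear_combination T σ * h2 - T ρ * h1
  have hG : ∀ ε σ : HalfChar g, ε ⬝ᵥ σ = 1 → ∃ κ, ∀ i j,
      4 * m * (thetaGradient τ ε σ i * thetaGradient τ ε σ j) = s i j * κ := by
    intro ε σ h
    refine ⟨∑ α, pairingSign α σ * (x α * T (α + ε) - x (α + ε) * T α), fun i j => ?_⟩
    have h1 := sum_pairingSign_mul_thetaA_of_odd τ i j h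
    rw [thetaC_zero] at h1
    have h2 : m * ∑ α, pairingSign α σ * thetaA 0 τ i j (α + ε) α =
        s i j * ∑ α, pairingSign α σ * (x α * T (α + ε) - x (α + ε) * T α) := by
      rw [Finset.mul_sum, Finset.mul_sum]
      exact Finset.sum_congr rfl fun α _ => by
        linear_combination pairingSign α σ * hA i j (α + ε) α
    linear_combination h2 - m * h1
  have hzero := fun v => eq_zero_of_forall_dotProduct_thetaGradient_eq_zero
    (one_le_two.trans hg) τ (v := v)
  by_cases hu : ∀ ε σ : HalfChar g, ε ⬝ᵥ σ = 1 → thetaGradient τ ε σ = 0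
  · have := hzero (Pi.single ⟨0, by lia⟩ 1) fun ε σ h => by rw [hu ε σ h, dotProduct_zero]
    exact one_ne_zero (Pi.single_eq_zero_iff.1 this)
  · push Not at hu
    obtain ⟨ε₁, σ₁, h₁, hu⟩ := hu
    set u := thetaGradient τ ε₁ σ₁
    obtain ⟨p, hp⟩ := Function.ne_iff.1 hu
    have : Nontrivial (Fin g) := Fin.nontrivial_iff_two_le.2 hg
    obtain ⟨q, hq⟩ := exists_ne p
    obtain ⟨κ₁, hκ₁⟩ := hG ε₁ σ₁ h₁
    have hp' : u p ≠ 0 := hp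
    have hκ₁0 : κ₁ ≠ 0 := by
      rintro rfl
      have := hκ₁ p p
      rw [mul_zero] at this
      exact mul_ne_zero (mul_ne_zero (by norm_num) hm0) (mul_ne_zero hp' hp') this
    -- This vector is orthogonal to `u` and nonzero because `u p ≠ 0`. All other odd gradients are
    -- proportional to `u`, so it is orthogonal to them too.
    have hv := hzero (Pi.single p (u q) - Pi.single q (u p)) fun ε σ h => ?_
    · have := congrFun hv q
      simp [hq] at this
      exact hp' this
    · rw [sub_dotProduct, single_dotProduct, single_dotProduct]
      obtain ⟨κ, hκ⟩ := hG ε σ h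
      set G := thetaGradient τ ε σ
      -- The square is the quadratic form of `G Gᵀ` at that vector. Both `G Gᵀ` and `u uᵀ` are
      -- multiples of `s`, the latter with `κ₁ ≠ 0`, and the form of `u uᵀ` vanishes there.
      have : 4 * m * κ₁ * (u q * G p - u p * G q) ^ 2 = 0 := by
        linear_combination κ₁ * u q ^ 2 * hκ p p - κ₁ * u q * u p * hκ p q
          - κ₁ * u q * u p * hκ q p
          + κ₁ * u p ^ 2 * hκ q q - κ * u q ^ 2 * hκ₁ p p + κ * u q * u p * hκ₁ p q
          + κ * u q * u p * hκ₁ q p - κ * u p ^ 2 * hκ₁ q q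
      exact pow_eq_zero_iff two_ne_zero |>.1 ((mul_eq_zero.1 this).resolve_left
        (mul_ne_zero (mul_ne_zero (by norm_num) hm0) hκ₁0))

theorem isProjectiveSolution_iff (hg : 2 ≤ g) (τ : SiegelUpperHalfSpace g)
    (p : ℙ ℂ (HalfChar g → ℂ)) :
    IsProjectiveSolution (thetaA 0 τ) p ↔
      p = Projectivization.mk ℂ (secondOrderThetaConstants τ)
        (secondOrderThetaConstants_ne_zero τ) := by
  constructor
  · induction p using Projectivization.ind with
    | h x hx =>
      intro h
      rw [Projectivization.mk_eq_mk_iff']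
      refine exists_smul_eq_of_solves hg τ (h x ?_)
      rw [Projectivization.submodule_mk]
      exact Submodule.mem_span_singleton_self x
  · rintro rfl x hx
    rw [Projectivization.submodule_mk] at hx
    obtain ⟨a, rfl⟩ := Submodule.mem_span_singleton.1 hx
    exact secondOrderThetaConstants_solves τ a

theorem exists_thetaA_eq_sum_of_PgrTh_le (hg : 1 ≤ g) {τ τ' : SiegelUpperHalfSpace g}
    (h : PgrTh τ' ≤ PgrTh τ) : ∃ M : Fin g → Fin g → ℂ, ∀ i j ε δ,
      thetaA 0 τ' i j ε δ = ∑ k, ∑ l, M i k * M j l * thetaA 0 τ k l ε δ := by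
  have h1 : ∀ i, ∃ c : Fin g → ℂ, ∑ k, c k • (fun c : OddChar g => grTh τ c k) =
      fun c => grTh τ' c i := fun i =>
    (Submodule.mem_span_range_iff_exists_fun ℂ).1 (h (Submodule.subset_span ⟨i, rfl⟩))
  choose M hM using h1
  have hgrad : ∀ i (ε σ : HalfChar g), ε ⬝ᵥ σ = 1 →
      thetaGradient τ' ε σ i = ∑ k, M i k * thetaGradient τ ε σ k := fun i ε σ hc => by
    simpa [grTh] using (congrFun (hM i) ⟨(ε, σ), hc⟩).symm
  refine ⟨M, fun i j ε δ => ?_⟩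
  obtain ⟨β, rfl⟩ : ∃ β, ε = δ + β := ⟨δ + ε, by rw [← add_assoc, HalfChar.add_self, zero_add]⟩
  simp only [thetaA_eq_sum_thetaC hg, thetaC_zero]
  calc _ = 1 / 2 ^ (g - 1) * ∑ σ : HalfChar g with β ⬝ᵥ σ = 1, ∑ k, ∑ l, M i k * M j l *
        (pairingSign δ σ * (2 * (thetaGradient τ β σ k * thetaGradient τ β σ l))) := by
        congr 1
        refine Finset.sum_congr rfl fun σ hσ => ?_
        have hc := (Finset.mem_filter.1 hσ).2
        rw [hgrad i β σ hc, hgrad j β σ hc, Finset.sum_mul_sum, Finset.mul_sum, Finset.mul_sum]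
        refine Finset.sum_congr rfl fun k _ => ?_
        rw [Finset.mul_sum, Finset.mul_sum]
        exact Finset.sum_congr rfl fun l _ => by ring
    _ = _ := by
        rw [Finset.sum_comm, Finset.mul_sum]
        refine Finset.sum_congr rfl fun k _ => ?_
        rw [Finset.sum_comm, Finset.mul_sum]
        refine Finset.sum_congr rfl fun l _ => ?_
        rw [← Finset.mul_sum]; ring

theorem SolvesThreeTermSystem.sum {A A' : Fin g → Fin g → HalfChar g → HalfChar g → ℂ}
    {M : Fin g → Fin g → ℂ} {x : HalfChar g → ℂ} (hx : SolvesThreeTermSystem A x)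
    (h : ∀ i j ε δ, A' i j ε δ = ∑ k, ∑ l, M i k * M j l * A k l ε δ) :
    SolvesThreeTermSystem A' x := by
  intro i j ε δ σ
  simp only [h, Finset.sum_mul, ← Finset.sum_add_distrib]
  exact Finset.sum_eq_zero fun k _ => Finset.sum_eq_zero fun l _ => by
    linear_combination M i k * M j l * hx k l ε δ σ

end Reconstruction

theorem mainTheorem4 (g : ℕ) (hg : 2 ≤ g) :
    ∃ hne : ∀ τ : SiegelUpperHalfSpace g, secondOrderThetaConstants τ ≠ 0,
      (∀ (τ : SiegelUpperHalfSpace g) (p : ℙ ℂ (HalfChar g → ℂ)),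
        IsProjectiveSolution (thetaA 0 τ) p ↔
          p = Projectivization.mk ℂ (secondOrderThetaConstants τ) (hne τ)) ∧
      (∀ (τ : SiegelUpperHalfSpace g) (i j : Fin g) (α ε : HalfChar g),
        thetaA 0 τ i j (α + ε) α =
          1 / 2 ^ (g - 1) *
            ∑ σ : HalfChar g with ε ⬝ᵥ σ = 1, pairingSign α σ * thetaC 0 τ i j ε σ) ∧
      (∀ τ τ' : SiegelUpperHalfSpace g, PgrTh τ = PgrTh τ' →
        Projectivization.mk ℂ (secondOrderThetaConstants τ) (hne τ) =
          Projectivization.mk ℂ (secondOrderThetaConstants τ') (hne τ')) := by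
  refine ⟨secondOrderThetaConstants_ne_zero, isProjectiveSolution_iff hg,
    thetaA_eq_sum_thetaC (one_le_two.trans hg), fun τ τ' h => ?_⟩
  -- One inclusion of spans suffices, and `M` need not be invertible: solutions for `τ` solve the
  -- system for `τ'`, where uniqueness applies.
  obtain ⟨M, hM⟩ := exists_thetaA_eq_sum_of_PgrTh_le (one_le_two.trans hg) h.ge
  rw [← isProjectiveSolution_iff hg τ']
  intro x hx
  exact ((isProjectiveSolution_iff hg τ _).2 rfl x hx).sum hM
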